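/- **Setting.** Let $\mu,\nu$ be probability measures on $\mathbb{R}$ with finite second moments, let $\lambda$ be Lebesgue measure, let $C$ be the convex hull of the support of $\nu$, and let $I$ be the interior of $C$. Assume (A'): - $\mu\le_{cx}\nu$, i.e. $\int\varphi\,d\mu\le\int\varphi\,d\nu$ for all convex $\varphi:\mathbb{R}\to\mathbb{R}$; - $(\mu,\nu)$ is irreducible: for all measurable $A,B\subseteq\mathbb{R}$ with $\mu(A),\nu(B)>0$ there is a martingale $(M_t)_{0\le t\le1}$ with $M_0\sim\mu$, $M_1\sim\nu$ and $\mathbb{P}(M_0\in A,\,M_1\in B)>0$; - $C$ is compact and $\operatorname{supp}\mu\subseteq I$; - $\nu\ll\lambda$ with $\lambda\text{-}\operatorname{ess\,inf}_{I}\frac{d\nu}{d\lambda}>0$ and $\lambda\text{-}\operatorname{ess\,sup}_{\mathbb{R}}\frac{d\nu}{d\lambda}<\infty$. Let $(\Omega,\mathcal{F},\mathbb{P})$ be a probability space carrying independent random variables $X\sim\mu$ and $\Gamma\sim N(0,1)$. Put $\mathcal{G}=\sigma(X)$, $\mathcal{H}=\sigma(X,\Gamma)$ and $$V(Z)=\sup_{Y\in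 L^2(\mathcal{H};\mathbb{R}),\ Y\sim\nu}\mathbb{E}[(Z+\Gamma)Y-ZX],\qquad Z\in L^2(\mathcal{G};\mathbb{R}).$$ Write $D_ZV\in L^2(\mathcal{G};\mathbb{R})$ for the $L^2$-gradient of $V$ at $Z$, i.e. the representative of the Fréchet derivative. **Statement.** For every $R>0$ there is $\varepsilon>0$ such that for all $Z_0,Z_1\in L^2(\mathcal{G};\mathbb{R})$ with $|Z_0|\le R$ and $|Z_1|\le R$ almost surely and $\mathbb{E}[Z_0]=\mathbb{E}[Z_1]$, the gradient $D_{Z_0}V$ exists and $$V(Z_1)-V(Z_0)-\langle D_{Z_0}V,\,Z_1-Z_0\rangle_{L^2}\ \ge\ \varepsilon\,\|Z_1-Z_0\|_{L^2}^2 .$$ In other words, for each $c\in\mathbb{R}$, $V$ is strongly convex (with modulus $2\varepsilon$) on the set of $Z\in L^2(\mathcal{G};\mathbb{R})$ with $|Z|\le R$ a.s. and $\mathbb{E}[Z]=c$; that is, for $Z,Z'$ in this set and $t\in[0,1]$, $$V((1-t)Z+tZ')\le(1-t)V(Z)+tV(Z')-\varepsilon\,t(1-t)\|Z-Z'\|_{L^2}^2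 .$$ -/

import Mathlib

open MeasureTheory ProbabilityTheory
open scoped ENNReal

noncomputable section

/-- Convex order `μ ≤_cx ν`: `∫ φ dμ ≤ ∫ φ dν` for every convex `φ : ℝ → ℝ`. For measures with finite
first moment the integral of a convex function is well defined in `(-∞, ∞]`; the inequality
has content only if the right-hand side is finite, and then the left-hand side is finite too. -/
def ConvexOrder (μ ν : Measure ℝ) : Prop :=
  ∀ φ : ℝ → ℝ, ConvexOn ℝ Set.univ φ → Integrable φ ν →
    Integrable φ μ ∧ ∫ x, φ x ∂μ ≤ ∫ x, φ x ∂ν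

/-- The pair `(μ, ν)` is irreducible: for all measurable `A`, `B` with `μ A > 0`, `ν B > 0` there is
a martingale `(M t)`, `0 ≤ t ≤ 1`, with `M 0 ∼ μ`, `M 1 ∼ ν` and `ℙ(M 0 ∈ A, M 1 ∈ B) > 0`. -/
def IrreduciblePair (μ ν : Measure ℝ) : Prop :=
  ∀ A B : Set ℝ, MeasurableSet A → MeasurableSet B → 0 < μ A → 0 < ν B →
    ∃ (Ω : Type) (mΩ : MeasurableSpace Ω) (P : Measure Ω) (ℱ : Filtration unitInterval mΩ)
      (M : unitInterval → Ω → ℝ),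
      IsProbabilityMeasure P ∧ Martingale M ℱ P ∧ P.map (M 0) = μ ∧ P.map (M 1) = ν ∧
        0 < P {ω | M 0 ω ∈ A ∧ M 1 ω ∈ B}

/-- The convex hull `C` of the support of a measure. -/
def supportHull (ρ : Measure ℝ) : Set ℝ := convexHull ℝ ρ.support

/-- Assumption (A) on a pair of probability measures on the line. -/
structure AssumptionA (μ ν : Measure ℝ) : Prop where
  convexOrder : ConvexOrder μ ν
  irreducible : IrreduciblePair μ ν
  isCompact_hull : IsCompact (supportHull ν)
  support_subset : μ.support ⊆ interior (supportHull ν)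

/-- Assumption (A'): Assumption (A), and `ν` has a Lebesgue density that is essentially bounded
away from zero on the interior of the convex hull of the support of `ν` and essentially bounded. -/
structure AssumptionA' (μ ν : Measure ℝ) : Prop extends AssumptionA μ ν where
  absolutelyContinuous : ν ≪ volume
  essInf_density_pos :
    0 < essInf (ν.rnDeriv volume) (volume.restrict (interior (supportHull ν)))
  essSup_density_lt_top : essSup (ν.rnDeriv volume) volume < ∞

/-- The sigma-algebra `𝒢 = σ(X)`. -/
abbrev sigmaX {Ω : Type*} (X : Ω → ℝ) : MeasurableSpace Ω :=
  MeasurableSpace.comap X inferInstance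

/-- The sigma-algebra `ℋ = σ(X, Γ)`. -/
abbrev sigmaXG {Ω : Type*} (X G : Ω → ℝ) : MeasurableSpace Ω :=
  MeasurableSpace.comap (fun ω => (X ω, G ω)) inferInstance

/-- The Hilbert space `L²(m; ℝ)` of square-integrable `m`-measurable random variables, for a
sub-sigma-algebra `m`, as a subspace of `L²(ℙ)`. -/
abbrev L2 {Ω : Type*} (m : MeasurableSpace Ω) [MeasurableSpace Ω] (P : Measure Ω) :
    Submodule ℝ (Lp ℝ 2 P) :=
  lpMeas ℝ ℝ m 2 P

/-- The lifted Bass functional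
`V(Z) = sup { 𝔼[(Z + Γ) Y - Z X] : Y ∈ L²(ℋ; ℝ), Y ∼ ν }` on `L²(𝒢; ℝ)`. -/
def bassV {Ω : Type*} [MeasurableSpace Ω] (P : Measure Ω) (X G : Ω → ℝ) (ν : Measure ℝ)
    (Z : L2 (sigmaX X) P) : ℝ :=
  sSup {r : ℝ | ∃ Y : L2 (sigmaXG X G) P, P.map (Y : Ω → ℝ) = ν ∧
    r = ∫ ω, (((Z : Ω → ℝ) ω + G ω) * (Y : Ω → ℝ) ω - (Z : Ω → ℝ) ω * X ω) ∂P}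

/-- `D` is the `L²`-gradient at `Z` of a functional `F` on `L²(m; ℝ)`: `F` is Fréchet differentiable
at `Z` with derivative `H ↦ ⟨D, H⟩`. -/
def IsL2Gradient {Ω : Type*} {m : MeasurableSpace Ω} [MeasurableSpace Ω] {P : Measure Ω}
    (F : L2 m P → ℝ) (D Z : L2 m P) : Prop :=
  HasFDerivAt F (innerSL ℝ D) Z

end

/-! ### Bregman divergence of the primitive of a monotone Lipschitz function -/

/-! The supremum defining `V(Z)` is attained at `Y_Z = T_Z(Z + Γ)`, with `T_Z` the increasing
transport of the law of `Z + Γ` to `ν`. That law has density at most 1 and `ν` has density at least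
`m` on its interval `[a, b]`, so `T_Z` is Lipschitz with constant `L = 1/m`. Its primitive then has
a Bregman divergence bounded below by squared increments of `T_Z` (`Monotone.sq_sub_le_bregman`),
and every competitor `Y ∼ ν` loses at least `‖Y_Z - Y‖² / (2L)` (`transport_gap`).

Testing `V(Z₁)` with the competitor `Y_{Z₀}` bounds the first-order remainder of `V` below by
`‖Y_{Z₁} - Y_{Z₀}‖² / (2L)`; exchanging `Z₀` and `Z₁` gives a quadratic upper bound, hence
differentiability, with gradient `𝔼[Y_Z - X | 𝒢]`.

It remains to bound `‖Y_{Z₁} - Y_{Z₀}‖` below by a multiple of `‖Z₁ - Z₀‖`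
(`mul_integral_sq_le_integral_sq_transport`). Put `D = Z₁ - Z₀`. Substituting `x = Z₀ + Γ` and
keeping only `x ∈ [0, 1]` leaves `𝔼[(T₀(x) - T₁(x + D))²]`, where `T₀(x)` is deterministic. Since
`T₁` has slope at least some `c > 0` on bounded intervals, this is at least `c² Var D`, which equals
`c² 𝔼[D²]` because the means agree. Constant shifts must be excluded: `V` is affine along them,
every competitor having the mean of `ν`. -/

theorem integral_affine (u v c d L : ℝ) :
    ∫ s in u..v, (c + L * (s - d)) = c * (v - u) + L / 2 * ((v - d) ^ 2 - (u - d) ^ 2) := by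
  have h1 : ∫ s in u..v, (s - d) = ((v - d) ^ 2 - (u - d) ^ 2) / 2 := by
    rw [intervalIntegral.integral_comp_sub_right (fun s => s) d, integral_id]
  have h2 : IntervalIntegrable (fun s : ℝ => L * (s - d)) volume u v :=
    (by fun_prop : Continuous fun s : ℝ => L * (s - d)).intervalIntegrable _ _
  have h3 : IntervalIntegrable (fun _ : ℝ => c) volume u v := intervalIntegrable_const
  rw [intervalIntegral.integral_add h3 h2, intervalIntegral.integral_const_mul, h1,
    intervalIntegral.integral_const, smul_eq_mul]
  ring

theorem Monotone.mul_sub_le_integral {T : ℝ → ℝ} (hT : Monotone T) (x y : ℝ) :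
    T y * (x - y) ≤ ∫ s in y..x, T s := by
  rcases le_total y x with h | h
  · have := intervalIntegral.integral_mono_on (μ := volume) h (f := fun _ => T y) (g := T) intervalIntegrable_const
      hT.intervalIntegrable fun s hs => hT hs.1
    simp only [intervalIntegral.integral_const, smul_eq_mul] at this
    linarith
  · have := intervalIntegral.integral_mono_on (μ := volume) h (f := T) (g := fun _ => T y)
      hT.intervalIntegrable intervalIntegrable_const fun s hs => hT hs.2
    simp only [intervalIntegral.integral_const, smul_eq_mul] at this
    rw [intervalIntegral.integral_symm]
    linarith

theorem Monotone.integral_le_of_lipschitz {T : ℝ → ℝ} (hT : Monotone T) {L : ℝ}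
    (hL : ∀ x y, x ≤ y → T y - T x ≤ L * (y - x)) (x y : ℝ) :
    ∫ s in y..x, T s ≤ T y * (x - y) + L / 2 * (x - y) ^ 2 := by
  have hi : ∀ u v : ℝ, IntervalIntegrable (fun s => T y + L * (s - y)) volume u v := fun u v => by
    apply Continuous.intervalIntegrable; fun_prop
  rcases le_total y x with h | h
  · have := intervalIntegral.integral_mono_on (μ := volume) h (f := T) (g := fun s => T y + L * (s - y))
      hT.intervalIntegrable (hi _ _) fun s hs => by linarith [hL y s hs.1]
    rw [integral_affine] at this
    simpa using this
  · have := intervalIntegral.integral_mono_on (μ := volume) h (g := T) (f := fun s => T y + L * (s - y))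
      (hi _ _) hT.intervalIntegrable fun s hs => by linarith [hL s y hs.2]
    rw [integral_affine] at this
    rw [intervalIntegral.integral_symm]
    nlinarith

/-- Cocoercivity of the derivative of a smooth convex function: compare the tangent at `y` with the
quadratic upper bound at `x`. -/
theorem Monotone.sq_sub_le_bregman {T : ℝ → ℝ} (hT : Monotone T) {L : ℝ} (hL0 : 0 < L)
    (hL : ∀ x y, x ≤ y → T y - T x ≤ L * (y - x)) (x y : ℝ) :
    (T x - T y) ^ 2 / (2 * L) ≤
      (∫ s in 0..x, T s) - (∫ s in 0..y, T s) - T y * (x - y) := by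
  -- A gradient step of length `1/L` from `x` for the primitive minus its tangent slope at `y`; this
  -- `z` makes the comparison sharpest.
  set z := x - (T x - T y) / L with hz
  have h1 := hT.mul_sub_le_integral z y
  have h2 := hT.integral_le_of_lipschitz hL z x
  have e1 := intervalIntegral.integral_interval_sub_left (μ := volume) (f := T) (a := 0) (b := z)
    (c := y) hT.intervalIntegrable hT.intervalIntegrable
  have e2 := intervalIntegral.integral_interval_sub_left (μ := volume) (f := T) (a := 0) (b := z)
    (c := x) hT.intervalIntegrable hT.intervalIntegrable
  have h3 : T y * (z - y) - T x * (z - x) - L / 2 * (z - x) ^ 2 - T y * (x - y)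
      = (T x - T y) ^ 2 / (2 * L) := by
    rw [hz]; field_simp; ring
  linarith

/-! ### Monotone transport from a law with strictly increasing Lipschitz distribution function -/

theorem cdf_sub_cdf (α : Measure ℝ) [IsProbabilityMeasure α] {x y : ℝ} (h : x ≤ y) :
    cdf α y - cdf α x = α.real (Set.Ioc x y) := by
  have := (cdf α).measure_Ioc x y
  rw [measure_cdf] at this
  rw [measureReal_def, this, ENNReal.toReal_ofReal (sub_nonneg.2 (monotone_cdf α h))]

theorem continuousOn_of_sub_le {f : ℝ → ℝ} {s : Set ℝ} (hf : Monotone f) (k : ℝ)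
    (h : ∀ x ∈ s, ∀ y ∈ s, x ≤ y → f y - f x ≤ k * (y - x)) : ContinuousOn f s := by
  have : LipschitzOnWith (Real.toNNReal k) f s := by
    refine LipschitzOnWith.of_dist_le_mul fun x hx y hy => ?_
    rw [Real.dist_eq, Real.dist_eq]
    have hk : k ≤ (Real.toNNReal k : ℝ) := Real.le_coe_toNNReal k
    rcases le_total x y with hxy | hxy
    · rw [abs_sub_comm, abs_sub_comm x, abs_of_nonneg (sub_nonneg.2 (hf hxy)),
        abs_of_nonneg (sub_nonneg.2 hxy)]
      exact (h x hx y hy hxy).trans (mul_le_mul_of_nonneg_right hk (sub_nonneg.2 hxy))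
    · rw [abs_of_nonneg (sub_nonneg.2 (hf hxy)), abs_of_nonneg (sub_nonneg.2 hxy)]
      exact (h y hy x hx hxy).trans (mul_le_mul_of_nonneg_right hk (sub_nonneg.2 hxy))
  exact this.continuousOn

/-- `T x` is the point of `[a, b]` where `cdf ν` equals `cdf α x`. Lower growth of `cdf ν` bounds
the slope of `T` above; upper growth bounds it below. -/
theorem exists_monotone_transport {α ν : Measure ℝ} [IsProbabilityMeasure α]
    [IsProbabilityMeasure ν] {a b m M k : ℝ} (hab : a ≤ b) (hm : 0 < m)
    (ha : cdf ν a = 0) (hb : cdf ν b = 1)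
    (hlow : ∀ x y, a ≤ x → x ≤ y → y ≤ b → m * (y - x) ≤ cdf ν y - cdf ν x)
    (hup : ∀ x y, x ≤ y → cdf ν y - cdf ν x ≤ M * (y - x))
    (hF : ∀ x y, x < y → cdf α x < cdf α y)
    (hFk : ∀ x y, x ≤ y → cdf α y - cdf α x ≤ k * (y - x)) :
    ∃ T : ℝ → ℝ, StrictMono T ∧ (∀ x y, x ≤ y → T y - T x ≤ k / m * (y - x)) ∧
      (∀ x y, x ≤ y → cdf α y - cdf α x ≤ M * (T y - T x)) ∧
      (∀ x, T x ∈ Set.Icc a b) ∧ α.map T = ν := by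
  have hHc : ContinuousOn (cdf ν) (Set.Icc a b) :=
    continuousOn_of_sub_le (monotone_cdf ν) M fun x _ y _ hxy => hup x y hxy
  have hFc : Continuous (cdf α) := by
    rw [← continuousOn_univ]
    exact continuousOn_of_sub_le (monotone_cdf α) k fun x _ y _ hxy => hFk x y hxy
  have hivt := intermediate_value_Icc hab hHc
  rw [ha, hb] at hivt
  have hex : ∀ x, ∃ t ∈ Set.Icc a b, cdf ν t = cdf α x := fun x =>
    hivt ⟨cdf_nonneg α x, cdf_le_one α x⟩
  choose T hTI hT using hex
  have hmono : StrictMono T := fun x y hxy => by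
    by_contra! h
    have := monotone_cdf ν h
    rw [hT, hT] at this
    exact absurd (hF x y hxy) (not_lt.2 this)
  refine ⟨T, hmono, fun x y hxy => ?_, fun x y hxy => ?_, hTI, ?_⟩
  · have h1 := hlow (T x) (T y) (hTI x).1 (hmono.monotone hxy) (hTI y).2
    rw [hT, hT] at h1
    have h2 := h1.trans (hFk x y hxy)
    rw [div_mul_eq_mul_div, le_div_iff₀ hm]
    linarith
  · have := hup (T x) (T y) (hmono.monotone hxy)
    rwa [hT, hT] at this
  have hTm : Measurable T := hmono.monotone.measurable
  have := Measure.isProbabilityMeasure_map (μ := α) hTm.aemeasurable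
  apply Measure.eq_of_cdf
  ext t
  rw [cdf_eq_real, measureReal_def, Measure.map_apply hTm measurableSet_Iic, ← measureReal_def]
  rcases lt_or_ge t a with hta | hta
  · have h0 : cdf ν t = 0 := le_antisymm (ha ▸ monotone_cdf ν hta.le) (cdf_nonneg ν t)
    have : T ⁻¹' Set.Iic t = ∅ := by
      ext x
      simpa using hta.trans_le (hTI x).1
    rw [this, h0, measureReal_empty]
  rcases le_or_gt b t with htb | htb
  · have h0 : cdf ν t = 1 := le_antisymm (cdf_le_one ν t) (hb ▸ monotone_cdf ν htb)
    have : T ⁻¹' Set.Iic t = Set.univ := by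
      ext x
      simpa using (hTI x).2.trans htb
    rw [this, h0, probReal_univ]
  have hiff : ∀ x, T x ≤ t ↔ cdf α x ≤ cdf ν t := fun x => by
    rw [← hT x]
    refine ⟨fun h => monotone_cdf ν h, fun h => ?_⟩
    by_contra! hlt
    have := hlow t (T x) hta hlt.le (hTI x).2
    nlinarith
  have hp1 : cdf ν t < 1 := by
    have := hlow t b hta htb.le le_rfl
    rw [hb] at this
    nlinarith
  have hpos : ∀ x, 0 < cdf α x := fun x =>
    (cdf_nonneg α (x - 1)).trans_lt (hF _ _ (by linarith))
  -- The value 0 (only at `t = a`) is not attained by `cdf α`; any other value is attained at some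
  -- `w`, and the preimage is the half-line up to `w`.
  rcases (cdf_nonneg ν t).eq_or_lt with h0 | h0
  · have : T ⁻¹' Set.Iic t = ∅ := by
      ext x
      simpa [← not_le, hiff, ← h0] using hpos x
    rw [this, ← h0, measureReal_empty]
  · obtain ⟨w, hw⟩ := mem_range_of_exists_le_of_exists_ge hFc
      (((tendsto_cdf_atBot α).eventually (Iic_mem_nhds h0)).exists)
      (((tendsto_cdf_atTop α).eventually (Ici_mem_nhds hp1)).exists)
    have hsm : StrictMono (cdf α) := fun x y h => hF x y h
    have : T ⁻¹' Set.Iic t = Set.Iic w := by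
      ext x
      simp only [Set.mem_preimage, Set.mem_Iic, hiff, ← hw, hsm.le_iff_le]
    rw [this, ← cdf_eq_real, hw]

/-! ### Gaussian smoothing -/

theorem gaussianPDFReal_std_le_one (x : ℝ) : gaussianPDFReal 0 1 x ≤ 1 := by
  rw [gaussianPDFReal_def]
  have h1 : (Real.sqrt (2 * Real.pi * (1 : NNReal)))⁻¹ ≤ 1 := by
    apply inv_le_one_of_one_le₀
    rw [Real.one_le_sqrt]
    have := Real.pi_gt_three
    norm_num
    linarith
  have h2 : Real.exp (-(x - 0) ^ 2 / (2 * (1 : NNReal))) ≤ 1 := by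
    rw [Real.exp_le_one_iff]
    have := sq_nonneg (x - 0)
    have : (0 : ℝ) ≤ x ^ 2 := sq_nonneg x
    norm_num
    linarith
  calc _ ≤ (1 : ℝ) * 1 := mul_le_mul h1 h2 (Real.exp_pos _).le zero_le_one
    _ = 1 := one_mul 1

theorem gaussianPDFReal_std_anti {x B : ℝ} (h : |x| ≤ B) :
    gaussianPDFReal 0 1 B ≤ gaussianPDFReal 0 1 x := by
  simp only [gaussianPDFReal_def]
  have : x ^ 2 ≤ B ^ 2 := sq_le_sq' (abs_le.1 h).1 (abs_le.1 h).2
  refine mul_le_mul_of_nonneg_left (Real.exp_le_exp.2 ?_) (by positivity)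
  simp only [sub_zero, NNReal.coe_one, mul_one]
  linarith

theorem cdf_gaussian_sub {x y : ℝ} (h : x ≤ y) :
    cdf (gaussianReal 0 1) y - cdf (gaussianReal 0 1) x
      = ∫ s in x..y, gaussianPDFReal 0 1 s := by
  rw [cdf_sub_cdf _ h, measureReal_def, gaussianReal_apply_eq_integral _ one_ne_zero,
    intervalIntegral.integral_of_le h, ENNReal.toReal_ofReal]
  exact integral_nonneg fun _ => gaussianPDFReal_nonneg _ _ _

theorem cdf_gaussian_sub_le {x y : ℝ} (h : x ≤ y) :
    cdf (gaussianReal 0 1) y - cdf (gaussianReal 0 1) x ≤ y - x := by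
  rw [cdf_gaussian_sub h]
  have := intervalIntegral.integral_mono_on (μ := volume) h (f := gaussianPDFReal 0 1) (g := fun _ => (1 : ℝ))
    (integrable_gaussianPDFReal 0 1).intervalIntegrable (by simp)
    fun s _ => gaussianPDFReal_std_le_one s
  simpa using this

theorem le_cdf_gaussian_sub {x y B : ℝ} (h : x ≤ y) (hx : -B ≤ x) (hy : y ≤ B) :
    gaussianPDFReal 0 1 B * (y - x) ≤
      cdf (gaussianReal 0 1) y - cdf (gaussianReal 0 1) x := by
  rw [cdf_gaussian_sub h]
  have := intervalIntegral.integral_mono_on (μ := volume) h (g := gaussianPDFReal 0 1)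
    (f := fun _ => gaussianPDFReal 0 1 B) (by simp)
    (integrable_gaussianPDFReal 0 1).intervalIntegrable
    fun s hs => gaussianPDFReal_std_anti (abs_le.2 ⟨hx.trans hs.1, hs.2.trans hy⟩)
  simpa [mul_comm] using this

theorem cdf_gaussian_strictMono : StrictMono (cdf (gaussianReal 0 1)) := fun x y h => by
  rw [← sub_pos, cdf_gaussian_sub h.le]
  exact intervalIntegral.intervalIntegral_pos_of_pos
    (integrable_gaussianPDFReal 0 1).intervalIntegrable
    (fun s => gaussianPDFReal_pos 0 1 s one_ne_zero) h

theorem cdf_conv_real (η γ : Measure ℝ) [IsProbabilityMeasure η] [IsProbabilityMeasure γ] (x : ℝ) :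
    cdf (η ∗ γ) x = ∫ z, cdf γ (x - z) ∂η := by
  rw [cdf_eq_real, measureReal_def, ← lintegral_indicator_one measurableSet_Iic,
    Measure.lintegral_conv (measurable_one.indicator measurableSet_Iic),
    integral_eq_lintegral_of_nonneg_ae (ae_of_all _ fun z => cdf_nonneg _ _)
      ((monotone_cdf γ).measurable.comp (by fun_prop)).aestronglyMeasurable]
  congr 1
  refine lintegral_congr fun z => ?_
  rw [ofReal_cdf, ← lintegral_indicator_one measurableSet_Iic]
  refine lintegral_congr fun g => ?_
  simp only [Set.indicator, Set.mem_Iic, le_sub_iff_add_le, add_comm z g, Pi.one_apply]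

theorem integrable_cdf_sub (η γ : Measure ℝ) [IsProbabilityMeasure η] (x : ℝ) :
    Integrable (fun z => cdf γ (x - z)) η := by
  refine Integrable.of_bound
    ((monotone_cdf γ).measurable.comp (by fun_prop)).aestronglyMeasurable 1 (ae_of_all _ fun z => ?_)
  rw [Real.norm_eq_abs, abs_of_nonneg (cdf_nonneg _ _)]
  exact cdf_le_one _ _

theorem cdf_conv_gaussian_sub (η : Measure ℝ) [IsProbabilityMeasure η] (x y : ℝ) :
    cdf (η ∗ gaussianReal 0 1) y - cdf (η ∗ gaussianReal 0 1) x
      = ∫ z, (cdf (gaussianReal 0 1) (y - z) - cdf (gaussianReal 0 1) (x - z)) ∂η := by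
  rw [cdf_conv_real, cdf_conv_real,
    integral_sub (integrable_cdf_sub _ _ _) (integrable_cdf_sub _ _ _)]

theorem cdf_conv_gaussian_lt (η : Measure ℝ) [IsProbabilityMeasure η] {x y : ℝ} (h : x < y) :
    cdf (η ∗ gaussianReal 0 1) x < cdf (η ∗ gaussianReal 0 1) y := by
  rw [← sub_pos, cdf_conv_gaussian_sub]
  have hp : ∀ z, 0 < cdf (gaussianReal 0 1) (y - z) - cdf (gaussianReal 0 1) (x - z) := fun z =>
    sub_pos.2 (cdf_gaussian_strictMono (by linarith))
  rw [integral_pos_iff_support_of_nonneg (fun z => (hp z).le)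
    ((integrable_cdf_sub _ _ _).sub (integrable_cdf_sub _ _ _))]
  have : Function.support (fun z => cdf (gaussianReal 0 1) (y - z)
      - cdf (gaussianReal 0 1) (x - z)) = Set.univ := by
    ext z; simpa using (hp z).ne'
  rw [this]
  simp

theorem cdf_conv_gaussian_sub_le (η : Measure ℝ) [IsProbabilityMeasure η] {x y : ℝ} (h : x ≤ y) :
    cdf (η ∗ gaussianReal 0 1) y - cdf (η ∗ gaussianReal 0 1) x ≤ y - x := by
  rw [cdf_conv_gaussian_sub]
  have := integral_mono (μ := η) ((integrable_cdf_sub η (gaussianReal 0 1) y).sub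
    (integrable_cdf_sub η (gaussianReal 0 1) x)) (integrable_const (y - x)) fun z => by
      have := cdf_gaussian_sub_le (x := x - z) (y := y - z) (by linarith)
      simp only [Pi.sub_apply]
      linarith
  simpa using this

theorem le_cdf_conv_gaussian_sub (η : Measure ℝ) [IsProbabilityMeasure η] {R B x y : ℝ}
    (hη : ∀ᵐ z ∂η, |z| ≤ R) (h : x ≤ y) (hx : -B ≤ x) (hy : y ≤ B) :
    gaussianPDFReal 0 1 (B + R) * (y - x) ≤
      cdf (η ∗ gaussianReal 0 1) y - cdf (η ∗ gaussianReal 0 1) x := by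
  rw [cdf_conv_gaussian_sub]
  have := integral_mono_ae (μ := η) (integrable_const (gaussianPDFReal 0 1 (B + R) * (y - x)))
    ((integrable_cdf_sub η (gaussianReal 0 1) y).sub
    (integrable_cdf_sub η (gaussianReal 0 1) x)) (by
      filter_upwards [hη] with z hz
      have hz := abs_le.1 hz
      have := le_cdf_gaussian_sub (x := x - z) (y := y - z) (B := B + R) (by linarith)
        (by linarith) (by linarith)
      simp only [Pi.sub_apply]
      linarith)
  simpa using this

/-! ### A variance lower bound -/

/-- Take `b` with `f b = a`, or the nearer endpoint of `[-B, B]` when `a` lies outside the range of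
`f` there. -/
theorem exists_mul_sq_sub_le {f : ℝ → ℝ} (hf : Continuous f) {B c : ℝ} (hB : 0 ≤ B) (hc : 0 ≤ c)
    (h : ∀ x y, -B ≤ x → x ≤ y → y ≤ B → c * (y - x) ≤ f y - f x) (a : ℝ) :
    ∃ b, ∀ s, |s| ≤ B → c ^ 2 * (s - b) ^ 2 ≤ (a - f s) ^ 2 := by
  have hsq : ∀ u v : ℝ, 0 ≤ u → c * u ≤ v → c ^ 2 * u ^ 2 ≤ v ^ 2 := fun u v hu huv => by
    rw [← mul_pow]
    exact pow_le_pow_left₀ (mul_nonneg hc hu) huv 2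
  rcases le_or_gt a (f (-B)) with h1 | h1
  · refine ⟨-B, fun s hs => ?_⟩
    obtain ⟨hs1, hs2⟩ := abs_le.1 hs
    rw [← neg_sub (f s) a, neg_sq]
    exact hsq _ _ (by linarith) (by linarith [h (-B) s le_rfl hs1 hs2])
  rcases le_or_gt (f B) a with h2 | h2
  · refine ⟨B, fun s hs => ?_⟩
    obtain ⟨hs1, hs2⟩ := abs_le.1 hs
    rw [← neg_sub B s, neg_sq]
    exact hsq _ _ (by linarith) (by linarith [h s B hs1 hs2 le_rfl])
  obtain ⟨b, ⟨hb1, hb2⟩, rfl⟩ := intermediate_value_Icc (by linarith) hf.continuousOn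
    (⟨h1.le, h2.le⟩ : a ∈ Set.Icc (f (-B)) (f B))
  refine ⟨b, fun s hs => ?_⟩
  obtain ⟨hs1, hs2⟩ := abs_le.1 hs
  rcases le_total s b with hsb | hsb
  · rw [← neg_sub b s, neg_sq]
    exact hsq _ _ (by linarith) (h s b hs1 hsb hb2)
  · rw [← neg_sub (f s), neg_sq]
    exact hsq _ _ (by linarith) (h b s hb1 hsb hs2)

/-- For centred `D`, the second moment about any `b` is at least the one about 0. -/
theorem mul_integral_sq_le_integral_sq_sub {Ω : Type*} [MeasurableSpace Ω] {Q : Measure Ω}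
    [IsProbabilityMeasure Q] {D : Ω → ℝ} (hDm : AEMeasurable D Q) {f : ℝ → ℝ} (hf : Continuous f)
    {B c : ℝ} (hB : 0 ≤ B) (hc : 0 ≤ c)
    (h : ∀ x y, -B ≤ x → x ≤ y → y ≤ B → c * (y - x) ≤ f y - f x)
    (hD : ∀ᵐ ω ∂Q, |D ω| ≤ B) (hD0 : ∫ ω, D ω ∂Q = 0) (a : ℝ)
    (hint : Integrable (fun ω => (a - f (D ω)) ^ 2) Q) :
    c ^ 2 * ∫ ω, D ω ^ 2 ∂Q ≤ ∫ ω, (a - f (D ω)) ^ 2 ∂Q := by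
  obtain ⟨b, hb⟩ := exists_mul_sq_sub_le hf hB hc h a
  have hDi : Integrable D Q := Integrable.of_bound hDm.aestronglyMeasurable B hD
  have hD2 : Integrable (fun ω => D ω ^ 2) Q :=
    Integrable.of_bound (hDm.pow_const 2).aestronglyMeasurable (B ^ 2) (by
      filter_upwards [hD] with ω hω
      rw [norm_pow]
      exact pow_le_pow_left₀ (norm_nonneg _) hω 2)
  have e : (fun ω => c ^ 2 * (D ω - b) ^ 2)
      = fun ω => c ^ 2 * D ω ^ 2 + (-2 * c ^ 2 * b * D ω + c ^ 2 * b ^ 2) := by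
    ext ω; ring
  have hi2 : Integrable (fun ω => -2 * c ^ 2 * b * D ω + c ^ 2 * b ^ 2) Q :=
    (hDi.const_mul _).add (integrable_const _)
  have hle : ∫ ω, c ^ 2 * (D ω - b) ^ 2 ∂Q ≤ ∫ ω, (a - f (D ω)) ^ 2 ∂Q :=
    integral_mono_ae (by rw [e]; exact (hD2.const_mul _).add hi2) hint (by
      filter_upwards [hD] with ω hω using hb _ hω)
  rw [e, integral_add (hD2.const_mul _) hi2, integral_add (hDi.const_mul _) (integrable_const _),
    integral_const_mul, integral_const_mul, hD0] at hle
  simp only [mul_zero, integral_const, probReal_univ, smul_eq_mul, one_mul, zero_add] at hle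
  nlinarith [mul_nonneg (sq_nonneg c) (sq_nonneg b)]

/-- Substitute `x = z + g`; for `x ∈ [0, 1]` the density is evaluated at `x - z`, of modulus at most
`R + 1 ≤ B`. -/
theorem integral_gaussian_shift_ge {h : ℝ → ℝ} (hh : Continuous h) (h0 : ∀ x, 0 ≤ h x) {K : ℝ}
    (hK : ∀ x, h x ≤ K) {R B z : ℝ} (hz : |z| ≤ R) (hB : R + 1 ≤ B) :
    gaussianPDFReal 0 1 B * ∫ x in Set.Icc (0 : ℝ) 1, h x
      ≤ ∫ g, h (z + g) ∂(gaussianReal 0 1) := by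
  have hint : Integrable (fun g => gaussianPDFReal 0 1 g • h (z + g)) := by
    simp only [smul_eq_mul]
    exact (integrable_gaussianPDFReal 0 1).mul_bdd (c := K)
      (Continuous.aestronglyMeasurable (by fun_prop)) (ae_of_all _ fun g => by
        rw [Real.norm_eq_abs, abs_of_nonneg (h0 _)]
        exact hK _)
  have hint' := hint.comp_sub_right z
  have hnn : ∀ x, 0 ≤ gaussianPDFReal 0 1 (x - z) • h (z + (x - z)) := fun x =>
    mul_nonneg (gaussianPDFReal_nonneg _ _ _) (h0 _)
  rw [integral_gaussianReal_eq_integral_smul one_ne_zero,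
    ← integral_sub_right_eq_self (μ := volume) _ z, ← integral_const_mul]
  refine le_trans ?_ (setIntegral_le_integral (s := Set.Icc (0 : ℝ) 1) hint' (ae_of_all _ hnn))
  refine setIntegral_mono_on ((hh.integrableOn_Icc).const_mul _) hint'.integrableOn
    measurableSet_Icc fun x hx => ?_
  have hz := abs_le.1 hz
  rw [add_sub_cancel, smul_eq_mul]
  exact mul_le_mul_of_nonneg_right (gaussianPDFReal_std_anti
    (abs_le.2 ⟨by linarith [hx.1], by linarith [hx.2]⟩)) (h0 x)

theorem mul_integral_sq_le_integral_sq_transport {ρ : Measure (ℝ × ℝ)} [IsProbabilityMeasure ρ]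
    {T₀ T₁ : ℝ → ℝ} (h₀ : Continuous T₀) (h₁ : Continuous T₁) {K : ℝ} (hK₀ : ∀ x, |T₀ x| ≤ K)
    (hK₁ : ∀ x, |T₁ x| ≤ K) {R B c : ℝ} (hB : 2 * R + 1 ≤ B) (hc : 0 ≤ c) (hR : 0 ≤ R)
    (h : ∀ x y, -B ≤ x → x ≤ y → y ≤ B → c * (y - x) ≤ T₁ y - T₁ x)
    (hρ₀ : ∀ᵐ p ∂ρ, |p.1| ≤ R) (hρ₁ : ∀ᵐ p ∂ρ, |p.2| ≤ R)
    (hρ : ∫ p, (p.2 - p.1) ∂ρ = 0) :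
    gaussianPDFReal 0 1 B * c ^ 2 * ∫ p, (p.2 - p.1) ^ 2 ∂ρ ≤
      ∫ q, (T₀ (q.1.1 + q.2) - T₁ (q.1.2 + q.2)) ^ 2 ∂(ρ.prod (gaussianReal 0 1)) := by
  have hbd : ∀ x y, (T₀ x - T₁ y) ^ 2 ≤ (2 * K) ^ 2 := fun x y => by
    have := abs_le.1 (hK₀ x)
    have := abs_le.1 (hK₁ y)
    exact sq_le_sq' (by linarith) (by linarith)
  have hbd' : ∀ x y, ‖(T₀ x - T₁ y) ^ 2‖ ≤ (2 * K) ^ 2 := fun x y => by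
    rw [Real.norm_eq_abs, abs_of_nonneg (sq_nonneg _)]
    exact hbd x y
  have hcont1 : Continuous fun q : (ℝ × ℝ) × ℝ => (T₀ (q.1.1 + q.2) - T₁ (q.1.2 + q.2)) ^ 2 := by
    fun_prop
  have hcont2 : Continuous fun q : (ℝ × ℝ) × ℝ => (T₀ q.2 - T₁ (q.2 + (q.1.2 - q.1.1))) ^ 2 := by
    fun_prop
  have hi1 := Integrable.of_bound (μ := ρ.prod (gaussianReal 0 1))
    hcont1.aestronglyMeasurable ((2 * K) ^ 2) (ae_of_all _ fun q => hbd' _ _)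
  have hi2 := Integrable.of_bound (μ := ρ.prod (volume.restrict (Set.Icc (0 : ℝ) 1)))
    hcont2.aestronglyMeasurable ((2 * K) ^ 2) (ae_of_all _ fun q => hbd' _ _)
  have hq := gaussianPDFReal_nonneg 0 1 B
  rw [integral_prod _ hi1]
  have hstep : gaussianPDFReal 0 1 B *
      (∫ p, (∫ x in Set.Icc (0 : ℝ) 1, (T₀ x - T₁ (x + (p.2 - p.1))) ^ 2) ∂ρ) ≤
      ∫ p, (∫ g, (T₀ (p.1 + g) - T₁ (p.2 + g)) ^ 2 ∂(gaussianReal 0 1)) ∂ρ := by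
    rw [← integral_const_mul]
    refine integral_mono_ae (hi2.integral_prod_left.const_mul _) hi1.integral_prod_left ?_
    filter_upwards [hρ₀] with p hp
    have := integral_gaussian_shift_ge (h := fun x => (T₀ x - T₁ (x + (p.2 - p.1))) ^ 2)
      (by fun_prop) (fun x => sq_nonneg _) (fun x => hbd _ _) hp (B := B) (by linarith)
    refine this.trans_eq ?_
    congr 1
    ext g
    congr 3
    ring
  refine le_trans ?_ hstep
  rw [mul_assoc]
  refine mul_le_mul_of_nonneg_left ?_ hq
  -- With `x` outermost, `T₀ x` is a constant and the variance bound applies to `p.2 - p.1`.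
  rw [integral_integral_swap hi2]
  have hx : ∀ x ∈ Set.Icc (0 : ℝ) 1, c ^ 2 * ∫ p, (p.2 - p.1) ^ 2 ∂ρ ≤
      ∫ p, (T₀ x - T₁ (x + (p.2 - p.1))) ^ 2 ∂ρ := fun x hx => by
    refine mul_integral_sq_le_integral_sq_sub (B := 2 * R) (f := fun s => T₁ (x + s))
      (by fun_prop) (by fun_prop) (by linarith) hc (fun s t hs hst ht => ?_) ?_ hρ (T₀ x) ?_
    · have := h (x + s) (x + t) (by linarith [hx.1]) (by linarith) (by linarith [hx.2])
      simpa using this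
    · filter_upwards [hρ₀, hρ₁] with p hp0 hp1
      have := abs_le.1 hp0
      have := abs_le.1 hp1
      exact abs_le.2 ⟨by linarith, by linarith⟩
    · exact Integrable.of_bound (Continuous.aestronglyMeasurable (by fun_prop)) ((2 * K) ^ 2)
        (ae_of_all _ fun q => hbd' _ _)
  have := setIntegral_mono_on (μ := volume) (s := Set.Icc (0 : ℝ) 1)
    (integrable_const (c ^ 2 * ∫ p, (p.2 - p.1) ^ 2 ∂ρ)) hi2.integral_prod_right
    measurableSet_Icc hx
  simpa using this

/-! ### Optimality gap of the monotone transport -/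

/-- `T` is injective, so `W' = T⁻¹(Y)` is defined almost surely and has the law of `W`. -/
theorem exists_monotone_rearrangement {Ω : Type*} [MeasurableSpace Ω] {P : Measure Ω}
    {T : ℝ → ℝ} (hT : StrictMono T) (hTc : Continuous T) {W Y : Ω → ℝ} (hW : AEMeasurable W P)
    (hY : AEMeasurable Y P) (hlaw : P.map Y = (P.map W).map T) :
    ∃ W' : Ω → ℝ, IdentDistrib W' W P P ∧ ∀ᵐ ω ∂P, Y ω = T (W' ω) := by
  have hemb : MeasurableEmbedding T := hTc.measurableEmbedding hT.injective
  obtain ⟨S, hSm, hS⟩ := hemb.exists_measurable_extend measurable_id (fun _ => ⟨0⟩)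
  refine ⟨S ∘ Y, ⟨hSm.comp_aemeasurable hY, hW, ?_⟩, ?_⟩
  · rw [← AEMeasurable.map_map_of_aemeasurable hSm.aemeasurable hY, hlaw,
      Measure.map_map hSm hemb.measurable, hS, Measure.map_id]
  · have h1 : ∀ᵐ y ∂(P.map Y), y ∈ Set.range T := by
      rw [hlaw]
      exact (ae_map_iff hemb.measurable.aemeasurable hemb.measurableSet_range).2
        (ae_of_all _ fun x => ⟨x, rfl⟩)
    filter_upwards [ae_of_ae_map hY h1] with ω ⟨x, hx⟩
    have : S (T x) = x := congrFun hS x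
    simp [← hx, this]

theorem transport_gap {Ω : Type*} [MeasurableSpace Ω] {P : Measure Ω} [IsProbabilityMeasure P]
    {T : ℝ → ℝ} (hT : StrictMono T) {L K : ℝ} (hL0 : 0 < L)
    (hL : ∀ x y, x ≤ y → T y - T x ≤ L * (y - x)) (hTc : Continuous T) (hK : ∀ x, |T x| ≤ K)
    {W Y : Ω → ℝ} (hW : Integrable W P)
    (hY : AEMeasurable Y P) (hlaw : P.map Y = (P.map W).map T) :
    (∫ ω, (T (W ω) - Y ω) ^ 2 ∂P) / (2 * L) ≤ ∫ ω, W ω * T (W ω) ∂P - ∫ ω, W ω * Y ω ∂P := by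
  obtain ⟨W', hid, hYW⟩ := exists_monotone_rearrangement hT hTc hW.aemeasurable hY hlaw
  set φ : ℝ → ℝ := fun x => ∫ s in 0..x, T s with hφ
  have hφc : Continuous φ :=
    intervalIntegral.continuous_primitive (fun _ _ => hTc.intervalIntegrable _ _) 0
  have hφb : ∀ x, |φ x| ≤ K * |x| := fun x => by
    have := intervalIntegral.norm_integral_le_of_norm_le_const (f := T) (C := K) (a := 0) (b := x)
      fun s _ => hK s
    simpa using this
  have hYK : ∀ᵐ ω ∂P, ‖Y ω‖ ≤ K := by
    filter_upwards [hYW] with ω hω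
    rw [hω]
    exact hK _
  have hφW : Integrable (fun ω => φ (W ω)) P :=
    (hW.norm.const_mul K).mono' (hφc.comp_aestronglyMeasurable hW.aestronglyMeasurable)
      (ae_of_all _ fun ω => hφb _)
  have hφid : IdentDistrib (fun ω => φ (W' ω)) (fun ω => φ (W ω)) P P := hid.comp hφc.measurable
  have hTid : IdentDistrib (fun ω => T (W' ω) * W' ω) (fun ω => T (W ω) * W ω) P P :=
    hid.comp (hTc.measurable.mul measurable_id)
  have hTW : Integrable (fun ω => T (W ω) * W ω) P :=
    hW.bdd_mul (hTc.comp_aestronglyMeasurable hW.aestronglyMeasurable) (ae_of_all _ fun ω => hK _)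
  have hYWi : Integrable (fun ω => Y ω * W ω) P :=
    hW.bdd_mul hY.aestronglyMeasurable hYK
  have hφW' := hφid.integrable_iff.2 hφW
  have hTW' := hTid.integrable_iff.2 hTW
  -- Integrate the Bregman bound at `(W, W')`. As `W` and `W'` share a law, the primitives cancel
  -- and `𝔼[T(W') W'] = 𝔼[T(W) W]`.
  have hmono := integral_mono_ae (μ := P) (f := fun ω => (T (W ω) - Y ω) ^ 2 / (2 * L))
    (g := fun ω => (φ (W ω) - φ (W' ω)) - (Y ω * W ω - T (W' ω) * W' ω)) ?_
    ((hφW.sub hφW').sub (hYWi.sub hTW')) ?_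
  · have e1 := integral_sub (hφW.sub hφW') (hYWi.sub hTW')
    simp only [Pi.sub_apply] at e1
    rw [integral_div, e1, integral_sub hφW hφW',
      integral_sub hYWi hTW', hφid.integral_eq, hTid.integral_eq] at hmono
    simp only [mul_comm (W _)]
    linarith
  · refine Integrable.div_const (Integrable.of_bound
      (((hTc.comp_aestronglyMeasurable hW.aestronglyMeasurable).sub
        hY.aestronglyMeasurable).pow 2) ((2 * K) ^ 2) ?_) _
    filter_upwards [hYK] with ω hω
    have h1 := abs_le.1 (hK (W ω))
    have h2 := abs_le.1 hω
    rw [Real.norm_eq_abs, abs_of_nonneg (sq_nonneg _)]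
    exact sq_le_sq' (by simp; linarith) (by simp; linarith)
  · filter_upwards [hYW] with ω hω
    have := hT.monotone.sq_sub_le_bregman hL0 hL (W ω) (W' ω)
    simp only [hω]
    linarith

/-! ### Distribution function bounds under Assumption (A') -/

theorem AssumptionA'.exists_cdf_bounds {μ ν : Measure ℝ} [IsProbabilityMeasure ν]
    (h : AssumptionA' μ ν) :
    ∃ a b m M : ℝ, a ≤ b ∧ 0 < m ∧ 0 < M ∧ cdf ν a = 0 ∧ cdf ν b = 1 ∧
      (∀ x y, a ≤ x → x ≤ y → y ≤ b → m * (y - x) ≤ cdf ν y - cdf ν x) ∧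
      (∀ x y, x ≤ y → cdf ν y - cdf ν x ≤ M * (y - x)) := by
  have hsub : ν.support ⊆ supportHull ν := subset_convexHull ℝ _
  have hne : (supportHull ν).Nonempty :=
    (Measure.nonempty_support (IsProbabilityMeasure.ne_zero ν)).mono hsub
  have hconn : IsConnected (supportHull ν) := ⟨hne, (convex_convexHull ℝ _).isPreconnected⟩
  have hIcc := eq_Icc_of_connected_compact hconn h.isCompact_hull
  set a := sInf (supportHull ν)
  set b := sSup (supportHull ν)
  have hab : a ≤ b := Set.nonempty_Icc.1 (hIcc ▸ hne)
  have hcompl : ν (Set.Icc a b)ᶜ = 0 :=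
    measure_mono_null (Set.compl_subset_compl.2 (hIcc ▸ hsub)) Measure.measure_compl_support
  have hdens := Measure.withDensity_rnDeriv_eq ν volume h.absolutelyContinuous
  have hIoc : ∀ x y, x ≤ y → cdf ν y - cdf ν x
      = (∫⁻ s in Set.Ioc x y, ν.rnDeriv volume s).toReal := fun x y hxy => by
    rw [cdf_sub_cdf ν hxy, measureReal_def, ← withDensity_apply _ measurableSet_Ioc, hdens]
  have hfin : ∀ x y, ∫⁻ s in Set.Ioc x y, ν.rnDeriv volume s ≠ ∞ := fun x y => by
    rw [← withDensity_apply _ measurableSet_Ioc, hdens]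
    exact measure_ne_top _ _
  set S := essSup (ν.rnDeriv volume) volume with hS
  -- Truncating at 1 keeps the lower bound finite, so that `toReal` preserves it.
  set I := min (essInf (ν.rnDeriv volume) (volume.restrict (interior (supportHull ν)))) 1 with hI
  have hI0 : 0 < I := lt_min h.essInf_density_pos one_pos
  have hItop : I ≠ ∞ := ne_top_of_le_ne_top ENNReal.one_ne_top (min_le_right _ _)
  have hStop : S ≠ ∞ := h.essSup_density_lt_top.ne
  refine ⟨a, b, I.toReal, S.toReal + 1, hab, ENNReal.toReal_pos hI0.ne' hItop, by positivity,
    ?_, ?_, fun x y hax hxy hyb => ?_, fun x y hxy => ?_⟩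
  · rw [cdf_eq_real, measureReal_def]
    have h1 : ν (Set.Iic a) = 0 := by
      rw [← Set.Iio_union_right]
      refine measure_union_null (measure_mono_null (fun x hx => ?_) hcompl)
        (h.absolutelyContinuous (by simp))
      simp only [Set.mem_compl_iff, Set.mem_Icc, not_and_or, not_le]
      exact Or.inl hx
    simp [h1]
  · rw [cdf_eq_real]
    have h1 : ν (Set.Iic b)ᶜ = 0 := by
      refine measure_mono_null (fun x hx => ?_) hcompl
      simp only [Set.mem_compl_iff, Set.mem_Icc, not_and_or, not_le, Set.mem_Iic] at hx ⊢
      exact Or.inr hx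
    rw [measureReal_def, (prob_compl_eq_zero_iff measurableSet_Iic).1 h1, ENNReal.toReal_one]
  · have hae : ∀ᵐ s ∂(volume.restrict (Set.Ioo x y)), I ≤ ν.rnDeriv volume s := by
      have h1 : ∀ᵐ s ∂(volume.restrict (interior (supportHull ν))), I ≤ ν.rnDeriv volume s := by
        filter_upwards [ae_essInf_le (f := ν.rnDeriv volume)] with s hs
          using (min_le_left _ _).trans hs
      refine ae_restrict_of_ae_restrict_of_subset ?_ h1
      rw [hIcc, interior_Icc]
      exact Set.Ioo_subset_Ioo hax hyb
    have h2 : I * ENNReal.ofReal (y - x) ≤ ∫⁻ s in Set.Ioc x y, ν.rnDeriv volume s :=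
      calc I * ENNReal.ofReal (y - x) = ∫⁻ _ in Set.Ioo x y, I := by simp
        _ ≤ ∫⁻ s in Set.Ioo x y, ν.rnDeriv volume s := lintegral_mono_ae hae
        _ ≤ _ := lintegral_mono_set Set.Ioo_subset_Ioc_self
    have h3 := ENNReal.toReal_mono (hfin x y) h2
    rwa [ENNReal.toReal_mul, ENNReal.toReal_ofReal (by linarith), ← hIoc x y hxy] at h3
  · have h2 : ∫⁻ s in Set.Ioc x y, ν.rnDeriv volume s ≤ S * ENNReal.ofReal (y - x) :=
      calc ∫⁻ s in Set.Ioc x y, ν.rnDeriv volume s ≤ ∫⁻ _ in Set.Ioc x y, S :=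
            lintegral_mono_ae (ae_restrict_of_ae ae_le_essSup)
        _ = _ := by simp
    have h3 := ENNReal.toReal_mono (ENNReal.mul_ne_top hStop ENNReal.ofReal_ne_top) h2
    rw [ENNReal.toReal_mul, ENNReal.toReal_ofReal (by linarith), ← hIoc x y hxy] at h3
    nlinarith

/-! ### Differentiability and strong convexity from an optimality gap -/

section OptimalityGap

variable {H : Type*} [NormedAddCommGroup H] [InnerProductSpace ℝ H] {S : Submodule ℝ H}
  {V : S → ℝ} {Y : S → H} {D : S → S} {x g : H} {L : ℝ}

theorem gradient_gap (hV : ∀ Z, V Z = inner ℝ ((Z : H) + g) (Y Z) - inner ℝ (Z : H) x)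
    (hgap : ∀ Z Z' : S, ‖Y Z - Y Z'‖ ^ 2 / (2 * L) ≤
      V Z - (inner ℝ ((Z : H) + g) (Y Z') - inner ℝ (Z : H) x))
    (hD : ∀ Z W : S, inner ℝ (D Z) W = inner ℝ (Y Z - x) (W : H)) (Z₀ Z₁ : S) :
    ‖Y Z₁ - Y Z₀‖ ^ 2 / (2 * L) ≤ V Z₁ - V Z₀ - inner ℝ (D Z₀) (Z₁ - Z₀) := by
  have h := hgap Z₁ Z₀
  rw [hD, hV Z₀]
  simp only [inner_add_left, inner_sub_left, inner_sub_right, Submodule.coe_sub,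
    real_inner_comm _ (Y Z₀), real_inner_comm _ x] at h ⊢
  linarith

theorem hasFDerivAt_of_gradient_gap (hL : 0 < L)
    (hV : ∀ Z, V Z = inner ℝ ((Z : H) + g) (Y Z) - inner ℝ (Z : H) x)
    (hgap : ∀ Z Z' : S, ‖Y Z - Y Z'‖ ^ 2 / (2 * L) ≤
      V Z - (inner ℝ ((Z : H) + g) (Y Z') - inner ℝ (Z : H) x))
    (hD : ∀ Z W : S, inner ℝ (D Z) W = inner ℝ (Y Z - x) (W : H)) (Z₀ : S) :
    HasFDerivAt V (innerSL ℝ (D Z₀)) Z₀ := by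
  have hbound : ∀ Z, ‖V Z - V Z₀ - inner ℝ (D Z₀) (Z - Z₀)‖ ≤ L * ‖Z - Z₀‖ ^ 2 := fun Z => by
    have h1 := gradient_gap hV hgap hD Z₀ Z
    have h2 := gradient_gap hV hgap hD Z Z₀
    -- Adding the two gaps cancels `V` and yields `‖Y Z - Y Z₀‖ ≤ L ‖Z - Z₀‖`, so the remainder is
    -- `O(‖Z - Z₀‖²)`.
    have h3 : inner ℝ (D Z) (Z₀ - Z) + inner ℝ (D Z₀) (Z - Z₀)
        = - inner ℝ (Y Z - Y Z₀) ((Z : H) - Z₀) := by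
      rw [hD, hD]
      simp only [inner_sub_left, inner_sub_right, Submodule.coe_sub]
      ring
    have h4 := real_inner_le_norm (Y Z - Y Z₀) ((Z : H) - Z₀)
    have hn : ‖(Z : H) - Z₀‖ = ‖Z - Z₀‖ := rfl
    rw [hn] at h4
    rw [norm_sub_rev] at h2
    set y := ‖Y Z - Y Z₀‖
    set d := ‖Z - Z₀‖
    have hy : 0 ≤ y := norm_nonneg _
    have hd : 0 ≤ d := norm_nonneg _
    have h5 : y ^ 2 / (2 * L) + y ^ 2 / (2 * L) = y ^ 2 / L := by field_simp; ring
    have h6 : y ^ 2 / L ≤ y * d := by linarith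
    rw [div_le_iff₀ hL] at h6
    have h7 : y ≤ L * d := by
      by_contra! hlt
      have : 0 < y := lt_of_le_of_lt (by positivity) hlt
      nlinarith
    have h8 : 0 ≤ y ^ 2 / (2 * L) := by positivity
    rw [Real.norm_eq_abs, abs_of_nonneg (by linarith)]
    nlinarith
  have hO : (fun Z => V Z - V Z₀ - inner ℝ (D Z₀) (Z - Z₀)) =O[nhds Z₀]
      fun Z => ‖Z - Z₀‖ ^ 2 := by
    refine Asymptotics.IsBigO.of_bound L (Filter.Eventually.of_forall fun Z => ?_)
    rw [Real.norm_of_nonneg (sq_nonneg ‖Z - Z₀‖)]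
    exact hbound Z
  have h1 := hO.hasFDerivAt (𝕜 := ℝ) one_lt_two
  have h2 := ((innerSL ℝ (D Z₀)).hasFDerivAt (x := Z₀)).add_const (V Z₀ - inner ℝ (D Z₀) Z₀)
  have h3 := h1.add h2
  rw [zero_add] at h3
  refine h3.congr_of_eventuallyEq (Filter.Eventually.of_forall fun Z => ?_)
  simp only [Pi.add_apply, innerSL_apply_apply, inner_sub_right]
  ring

/-- Use the first-order bound at the intermediate point towards both ends; in the weighted sum the
gradient terms cancel. -/
theorem strongConvexOn_of_gradient_le {E : Type*} [NormedAddCommGroup E] [InnerProductSpace ℝ E]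
    {V : E → ℝ} {D : E → E} {s : Set E} {ε : ℝ} (hs : Convex ℝ s)
    (h : ∀ Z₀ ∈ s, ∀ Z₁ ∈ s, ε * ‖Z₁ - Z₀‖ ^ 2 ≤ V Z₁ - V Z₀ - inner ℝ (D Z₀) (Z₁ - Z₀)) :
    StrongConvexOn s (2 * ε) V := by
  refine ⟨hs, fun u hu v hv a b ha hb hab => ?_⟩
  have hz := hs hu hv ha hb hab
  set z := a • u + b • v with hzdef
  have h1 := h z hz u hu
  have h2 := h z hz v hv
  obtain rfl : a = 1 - b := by linarith
  have e1 : u - z = b • (u - v) := by rw [hzdef]; module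
  have e2 : v - z = -(1 - b) • (u - v) := by rw [hzdef]; module
  rw [e1, norm_smul, inner_smul_right, mul_pow, Real.norm_eq_abs, sq_abs] at h1
  rw [e2, norm_smul, inner_smul_right, mul_pow, Real.norm_eq_abs, sq_abs] at h2
  have h1' := mul_le_mul_of_nonneg_left h1 ha
  have h2' := mul_le_mul_of_nonneg_left h2 hb
  simp only [smul_eq_mul]
  have e3 : (1 - b) * (ε * (b ^ 2 * ‖u - v‖ ^ 2)) + b * (ε * ((-(1 - b)) ^ 2 * ‖u - v‖ ^ 2))
      = (1 - b) * b * (2 * ε / 2 * ‖u - v‖ ^ 2) := by ring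
  linarith

end OptimalityGap

/-! ### The lifted Bass functional -/

theorem L2_integral_mul {Ω : Type*} [MeasurableSpace Ω] {P : Measure Ω} (f g : Lp ℝ 2 P) :
    inner ℝ f g = ∫ ω, f ω * g ω ∂P := by
  rw [MeasureTheory.L2.inner_def]
  refine integral_congr_ae (ae_of_all _ fun ω => ?_)
  simp [mul_comm]

theorem L2_integrable_mul {Ω : Type*} [MeasurableSpace Ω] {P : Measure Ω} (f g : Lp ℝ 2 P) :
    Integrable (fun ω => f ω * g ω) P := by
  simpa [mul_comm] using MeasureTheory.L2.integrable_inner (𝕜 := ℝ) f g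

theorem L2_norm_sub_sq {Ω : Type*} [MeasurableSpace Ω] {P : Measure Ω} (f g : Lp ℝ 2 P) :
    ‖f - g‖ ^ 2 = ∫ ω, (f ω - g ω) ^ 2 ∂P := by
  rw [← real_inner_self_eq_norm_sq, L2_integral_mul]
  refine integral_congr_ae ?_
  filter_upwards [Lp.coeFn_sub f g] with ω hω
  rw [hω, Pi.sub_apply, sq]

section Bass

theorem sigmaX_le_sigmaXG {Ω : Type*} (X G : Ω → ℝ) : sigmaX X ≤ sigmaXG X G := by
  rintro s ⟨t, ht, rfl⟩
  exact ⟨Prod.fst ⁻¹' t, measurable_fst ht, rfl⟩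

variable {Ω : Type*} [MeasurableSpace Ω] {P : Measure Ω} {X G : Ω → ℝ}

theorem indepFun_of_aestronglyMeasurable_sigmaX {β : Type*} [TopologicalSpace β]
    [TopologicalSpace.PseudoMetrizableSpace β] [MeasurableSpace β] [BorelSpace β]
    (hXG : IndepFun X G P) {f : Ω → β} (hf : AEStronglyMeasurable[sigmaX X] f P) :
    IndepFun f G P := by
  have h1 : IndepFun (hf.mk f) G P := by
    rw [IndepFun_iff_Indep] at hXG ⊢
    exact indep_of_indep_of_le_left hXG hf.stronglyMeasurable_mk.measurable.comap_le
  exact h1.congr hf.ae_eq_mk.symm Filter.EventuallyEq.rfl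

theorem bass_pairing {X' G' : Lp ℝ 2 P} (hX' : (X' : Ω → ℝ) =ᵐ[P] X)
    (hG' : (G' : Ω → ℝ) =ᵐ[P] G) (Z : L2 (sigmaX X) P) (Y : Lp ℝ 2 P) :
    ∫ ω, (((Z : Ω → ℝ) ω + G ω) * (Y : Ω → ℝ) ω - (Z : Ω → ℝ) ω * X ω) ∂P =
      inner ℝ ((Z : Lp ℝ 2 P) + G') Y - inner ℝ (Z : Lp ℝ 2 P) X' := by
  rw [L2_integral_mul, L2_integral_mul, ← integral_sub (L2_integrable_mul _ _)
    (L2_integrable_mul _ _)]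
  refine integral_congr_ae ?_
  filter_upwards [hX', hG', Lp.coeFn_add (Z : Lp ℝ 2 P) G'] with ω h1 h2 h3
  rw [h3, Pi.add_apply, h1, h2]

variable [IsProbabilityMeasure P]

theorem exists_bass_transport {ν : Measure ℝ} [IsProbabilityMeasure ν]
    (hG : Measurable G) (hGγ : P.map G = gaussianReal 0 1) (hXG : IndepFun X G P)
    {a b m M : ℝ} (hab : a ≤ b) (hm : 0 < m) (hM : 0 < M)
    (ha : cdf ν a = 0) (hb : cdf ν b = 1)
    (hlow : ∀ x y, a ≤ x → x ≤ y → y ≤ b → m * (y - x) ≤ cdf ν y - cdf ν x)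
    (hup : ∀ x y, x ≤ y → cdf ν y - cdf ν x ≤ M * (y - x)) (Z : L2 (sigmaX X) P) :
    ∃ T : ℝ → ℝ, StrictMono T ∧ Continuous T ∧ (∀ x y, x ≤ y → T y - T x ≤ 1 / m * (y - x)) ∧
      (∀ x, |T x| ≤ max |a| |b|) ∧ (P.map fun ω => (Z : Ω → ℝ) ω + G ω).map T = ν ∧
      ∀ R B : ℝ, (∀ᵐ ω ∂P, |(Z : Ω → ℝ) ω| ≤ R) → ∀ x y, -B ≤ x → x ≤ y → y ≤ B →
        gaussianPDFReal 0 1 (B + R) / M * (y - x) ≤ T y - T x := by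
  have hZm : AEMeasurable (Z : Ω → ℝ) P := (Lp.stronglyMeasurable (Z : Lp ℝ 2 P)).measurable.aemeasurable
  have hind := indepFun_of_aestronglyMeasurable_sigmaX hXG (lpMeas.aestronglyMeasurable Z)
  have hlaw : P.map (fun ω => (Z : Ω → ℝ) ω + G ω) = P.map (Z : Ω → ℝ) ∗ gaussianReal 0 1 := by
    rw [← hGγ]
    exact hind.map_add_eq_map_conv_map₀ hZm hG.aemeasurable
  have := Measure.isProbabilityMeasure_map hZm
  rw [hlaw]
  obtain ⟨T, hT, hTL, hTM, hTI, hTν⟩ := exists_monotone_transport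
    (α := P.map (Z : Ω → ℝ) ∗ gaussianReal 0 1) (k := 1) hab hm ha hb hlow hup
    (fun x y hxy => cdf_conv_gaussian_lt _ hxy)
    (fun x y hxy => by simpa using cdf_conv_gaussian_sub_le _ hxy)
  refine ⟨T, hT, ?_, hTL, fun x => abs_le_max_abs_abs (hTI x).1 (hTI x).2, hTν,
    fun R B hZR x y hx hxy hy => ?_⟩
  · rw [← continuousOn_univ]
    exact continuousOn_of_sub_le hT.monotone (1 / m) fun x _ y _ hxy => hTL x y hxy
  · have hη : ∀ᵐ z ∂(P.map (Z : Ω → ℝ)), |z| ≤ R :=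
      (ae_map_iff hZm (measurableSet_le measurable_norm measurable_const)).2 hZR
    have h1 := (le_cdf_conv_gaussian_sub _ hη hxy hx hy).trans (hTM x y hxy)
    rw [div_mul_eq_mul_div, div_le_iff₀ hM]
    linarith

theorem exists_L2_comp {T : ℝ → ℝ} (hTc : Continuous T) {K : ℝ} (hK : ∀ x, |T x| ≤ K)
    (hX : Measurable X) (hG : Measurable G) (Z : L2 (sigmaX X) P) :
    ∃ Y : L2 (sigmaXG X G) P, (Y : Ω → ℝ) =ᵐ[P] fun ω => T ((Z : Ω → ℝ) ω + G ω) := by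
  have hGm : Measurable[sigmaXG X G] G := by
    rintro s hs
    exact ⟨Prod.snd ⁻¹' s, measurable_snd hs, rfl⟩
  have hle : sigmaXG X G ≤ ‹MeasurableSpace Ω› := (hX.prodMk hG).comap_le
  have hmeas : AEStronglyMeasurable[sigmaXG X G] (fun ω => T ((Z : Ω → ℝ) ω + G ω)) P :=
    hTc.comp_aestronglyMeasurable
      (((lpMeas.aestronglyMeasurable Z).mono (sigmaX_le_sigmaXG X G)).add
        hGm.stronglyMeasurable.aestronglyMeasurable)
  have hLp : MemLp (fun ω => T ((Z : Ω → ℝ) ω + G ω)) 2 P :=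
    MemLp.of_bound (hmeas.mono hle) K (ae_of_all _ fun ω => hK _)
  exact ⟨⟨hLp.toLp _, mem_lpMeas_iff_aestronglyMeasurable.2 (hmeas.congr hLp.coeFn_toLp.symm)⟩,
    hLp.coeFn_toLp⟩

theorem bass_optimal {ν : Measure ℝ} {X' G' : Lp ℝ 2 P} (hX' : (X' : Ω → ℝ) =ᵐ[P] X)
    (hG' : (G' : Ω → ℝ) =ᵐ[P] G) {L K : ℝ} (hL0 : 0 < L) {T : ℝ → ℝ} (hT : StrictMono T)
    (hTc : Continuous T) (hL : ∀ x y, x ≤ y → T y - T x ≤ L * (y - x)) (hK : ∀ x, |T x| ≤ K)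
    (hG : Measurable G) (Z : L2 (sigmaX X) P)
    (hν : (P.map fun ω => (Z : Ω → ℝ) ω + G ω).map T = ν) (Y : L2 (sigmaXG X G) P)
    (hY : (Y : Ω → ℝ) =ᵐ[P] fun ω => T ((Z : Ω → ℝ) ω + G ω)) :
    P.map (Y : Ω → ℝ) = ν ∧
    bassV P X G ν Z = inner ℝ ((Z : Lp ℝ 2 P) + G') (Y : Lp ℝ 2 P) - inner ℝ (Z : Lp ℝ 2 P) X' ∧
    ∀ Y' : L2 (sigmaXG X G) P, P.map (Y' : Ω → ℝ) = ν →
      ‖(Y : Lp ℝ 2 P) - Y'‖ ^ 2 / (2 * L) ≤ bassV P X G ν Z -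
        (inner ℝ ((Z : Lp ℝ 2 P) + G') (Y' : Lp ℝ 2 P) - inner ℝ (Z : Lp ℝ 2 P) X') := by
  have hZm : Measurable (Z : Ω → ℝ) := (Lp.stronglyMeasurable (Z : Lp ℝ 2 P)).measurable
  have hlawY : P.map (Y : Ω → ℝ) = ν := by
    rw [Measure.map_congr hY, ← hν, Measure.map_map hTc.measurable (by fun_prop)]
    rfl
  have hWi : Integrable (fun ω => (Z : Ω → ℝ) ω + G ω) P :=
    (((Lp.memLp (Z : Lp ℝ 2 P)).integrable one_le_two)).add
      ((memLp_congr_ae hG').1 (Lp.memLp G') |>.integrable one_le_two)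
  have hin : ∀ U : Lp ℝ 2 P, inner ℝ ((Z : Lp ℝ 2 P) + G') U
      = ∫ ω, ((Z : Ω → ℝ) ω + G ω) * U ω ∂P := fun U => by
    rw [L2_integral_mul]
    refine integral_congr_ae ?_
    filter_upwards [hG', Lp.coeFn_add (Z : Lp ℝ 2 P) G'] with ω h2 h3
    rw [h3, Pi.add_apply, h2]
  have hgap : ∀ Y' : L2 (sigmaXG X G) P, P.map (Y' : Ω → ℝ) = ν →
      ‖(Y : Lp ℝ 2 P) - Y'‖ ^ 2 / (2 * L) ≤
        inner ℝ ((Z : Lp ℝ 2 P) + G') (Y : Lp ℝ 2 P)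
        - inner ℝ ((Z : Lp ℝ 2 P) + G') (Y' : Lp ℝ 2 P) := fun Y' hY' => by
    have h := transport_gap hT hL0 hL hTc hK hWi
      (Lp.stronglyMeasurable (Y' : Lp ℝ 2 P)).measurable.aemeasurable (hY'.trans hν.symm)
    rw [hin, hin, L2_norm_sub_sq]
    refine le_trans (le_of_eq ?_) (h.trans (le_of_eq ?_))
    · congr 1
      refine integral_congr_ae ?_
      filter_upwards [hY] with ω hω
      rw [hω]
    · congr 1
      refine integral_congr_ae ?_
      filter_upwards [hY] with ω hω
      rw [hω]
  have hV : bassV P X G ν Z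
      = inner ℝ ((Z : Lp ℝ 2 P) + G') (Y : Lp ℝ 2 P) - inner ℝ (Z : Lp ℝ 2 P) X' := by
    refine IsGreatest.csSup_eq ⟨⟨Y, hlawY, (bass_pairing hX' hG' Z Y).symm⟩, ?_⟩
    rintro r ⟨Y', hY', rfl⟩
    rw [bass_pairing hX' hG' Z Y']
    have := hgap Y' hY'
    have : 0 ≤ ‖(Y : Lp ℝ 2 P) - Y'‖ ^ 2 / (2 * L) := by positivity
    linarith
  refine ⟨hlawY, hV, fun Y' hY' => ?_⟩
  rw [hV]
  linarith [hgap Y' hY']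

/-- Since `(Z₀, Z₁)` is independent of `G`, their joint law is a product and the estimate becomes
one on `ℝ² × ℝ`. -/
theorem mul_norm_sub_sq_le_of_transport (hG : Measurable G)
    (hGγ : P.map G = gaussianReal 0 1) (hXG : IndepFun X G P) {T₀ T₁ : ℝ → ℝ}
    (h₀ : Continuous T₀) (h₁ : Continuous T₁) {K : ℝ} (hK₀ : ∀ x, |T₀ x| ≤ K)
    (hK₁ : ∀ x, |T₁ x| ≤ K) {R B c : ℝ} (hB : 2 * R + 1 ≤ B) (hc : 0 ≤ c) (hR : 0 ≤ R)
    (h : ∀ x y, -B ≤ x → x ≤ y → y ≤ B → c * (y - x) ≤ T₁ y - T₁ x)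
    {Z₀ Z₁ : L2 (sigmaX X) P} (hZ₀ : ∀ᵐ ω ∂P, |(Z₀ : Ω → ℝ) ω| ≤ R)
    (hZ₁ : ∀ᵐ ω ∂P, |(Z₁ : Ω → ℝ) ω| ≤ R)
    (hmean : ∫ ω, (Z₁ : Ω → ℝ) ω ∂P = ∫ ω, (Z₀ : Ω → ℝ) ω ∂P) {Y₀ Y₁ : Lp ℝ 2 P}
    (hY₀ : (Y₀ : Ω → ℝ) =ᵐ[P] fun ω => T₀ ((Z₀ : Ω → ℝ) ω + G ω))
    (hY₁ : (Y₁ : Ω → ℝ) =ᵐ[P] fun ω => T₁ ((Z₁ : Ω → ℝ) ω + G ω)) :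
    gaussianPDFReal 0 1 B * c ^ 2 * ‖Z₁ - Z₀‖ ^ 2 ≤ ‖Y₁ - Y₀‖ ^ 2 := by
  have hm₀ : Measurable (Z₀ : Ω → ℝ) := (Lp.stronglyMeasurable (Z₀ : Lp ℝ 2 P)).measurable
  have hm₁ : Measurable (Z₁ : Ω → ℝ) := (Lp.stronglyMeasurable (Z₁ : Lp ℝ 2 P)).measurable
  set U : Ω → ℝ × ℝ := fun ω => ((Z₀ : Ω → ℝ) ω, (Z₁ : Ω → ℝ) ω) with hU
  have hUm : Measurable U := hm₀.prodMk hm₁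
  have hind : IndepFun U G P := indepFun_of_aestronglyMeasurable_sigmaX hXG
    ((lpMeas.aestronglyMeasurable Z₀).prodMk (lpMeas.aestronglyMeasurable Z₁))
  have hprod : P.map (fun ω => (U ω, G ω)) = (P.map U).prod (gaussianReal 0 1) := by
    rw [hind.map_prod_eq_prod_map_map hUm.aemeasurable hG.aemeasurable, hGγ]
  have := Measure.isProbabilityMeasure_map (μ := P) hUm.aemeasurable
  have key := mul_integral_sq_le_integral_sq_transport (ρ := P.map U) h₀ h₁ hK₀ hK₁ hB hc hR h
    ((ae_map_iff hUm.aemeasurable (measurableSet_le (by fun_prop) measurable_const)).2 hZ₀)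
    ((ae_map_iff hUm.aemeasurable (measurableSet_le (by fun_prop) measurable_const)).2 hZ₁) (by
      rw [integral_map hUm.aemeasurable (by fun_prop), integral_sub
        ((Lp.memLp (Z₁ : Lp ℝ 2 P)).integrable one_le_two)
        ((Lp.memLp (Z₀ : Lp ℝ 2 P)).integrable one_le_two), hmean, sub_self])
  rw [← hprod, integral_map hUm.aemeasurable (by fun_prop),
    integral_map (hUm.prodMk hG).aemeasurable (by fun_prop)] at key
  have e1 : ‖Z₁ - Z₀‖ ^ 2 = ∫ ω, ((U ω).2 - (U ω).1) ^ 2 ∂P :=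
    L2_norm_sub_sq (Z₁ : Lp ℝ 2 P) Z₀
  rw [e1, norm_sub_rev, L2_norm_sub_sq]
  refine key.trans_eq (integral_congr_ae ?_)
  filter_upwards [hY₀, hY₁] with ω h1 h2
  rw [h1, h2]

theorem convex_bounded_mean (R c : ℝ) :
    Convex ℝ {Z : L2 (sigmaX X) P |
      (∀ᵐ ω ∂P, |(Z : Ω → ℝ) ω| ≤ R) ∧ ∫ ω, (Z : Ω → ℝ) ω ∂P = c} := by
  rintro U ⟨hU, hUc⟩ W ⟨hW, hWc⟩ a b ha hb hab
  have e : ((a • U + b • W : L2 (sigmaX X) P) : Ω → ℝ) =ᵐ[P]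
      fun ω => a * (U : Ω → ℝ) ω + b * (W : Ω → ℝ) ω := by
    filter_upwards [Lp.coeFn_add (a • (U : Lp ℝ 2 P)) (b • (W : Lp ℝ 2 P)),
      Lp.coeFn_smul a (U : Lp ℝ 2 P), Lp.coeFn_smul b (W : Lp ℝ 2 P)] with ω h1 h2 h3
    rw [Submodule.coe_add, Submodule.coe_smul, Submodule.coe_smul, h1, Pi.add_apply, h2, h3]
    rfl
  refine ⟨?_, ?_⟩
  · filter_upwards [e, hU, hW] with ω h1 h2 h3
    rw [h1]
    calc |a * (U : Ω → ℝ) ω + b * (W : Ω → ℝ) ω|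
        ≤ |a * (U : Ω → ℝ) ω| + |b * (W : Ω → ℝ) ω| := abs_add_le _ _
      _ = a * |(U : Ω → ℝ) ω| + b * |(W : Ω → ℝ) ω| := by
        rw [abs_mul, abs_mul, abs_of_nonneg ha, abs_of_nonneg hb]
      _ ≤ a * R + b * R := by gcongr
      _ = R := by rw [← add_mul, hab, one_mul]
  · rw [integral_congr_ae e, integral_add
      (((Lp.memLp (U : Lp ℝ 2 P)).integrable one_le_two).const_mul a)
      (((Lp.memLp (W : Lp ℝ 2 P)).integrable one_le_two).const_mul b),
      integral_const_mul, integral_const_mul, hUc, hWc, ← add_mul, hab, one_mul]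

end Bass

theorem mainTheorem6 {Ω : Type*} [MeasurableSpace Ω] (P : Measure Ω) [IsProbabilityMeasure P]
    (μ ν : Measure ℝ) [IsProbabilityMeasure μ] [IsProbabilityMeasure ν]
    (hμ : MemLp id 2 μ) (hν : MemLp id 2 ν)
    (X G : Ω → ℝ) (hX : Measurable X) (hG : Measurable G)
    (hXμ : P.map X = μ) (hGγ : P.map G = gaussianReal 0 1) (hXG : IndepFun X G P)
    (hA' : AssumptionA' μ ν) (R : ℝ) (hR : 0 < R) :
    ∃ ε : ℝ, 0 < ε ∧
      (∀ Z₀ Z₁ : L2 (sigmaX X) P,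
        (∀ᵐ ω ∂P, |(Z₀ : Ω → ℝ) ω| ≤ R) → (∀ᵐ ω ∂P, |(Z₁ : Ω → ℝ) ω| ≤ R) →
        ∫ ω, (Z₁ : Ω → ℝ) ω ∂P = ∫ ω, (Z₀ : Ω → ℝ) ω ∂P →
        ∃ D : L2 (sigmaX X) P, IsL2Gradient (bassV P X G ν) D Z₀ ∧
          bassV P X G ν Z₁ - bassV P X G ν Z₀ - inner ℝ D (Z₁ - Z₀) ≥ ε * ‖Z₁ - Z₀‖ ^ 2) ∧
      (∀ c : ℝ, StrongConvexOn
        {Z : L2 (sigmaX X) P | (∀ᵐ ω ∂P, |(Z : Ω → ℝ) ω| ≤ R) ∧ ∫ ω, (Z : Ω → ℝ) ω ∂P = c}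
        (2 * ε) (bassV P X G ν)) := by
  obtain ⟨a, b, m, M, hab, hm, hM, ha, hb, hlow, hup⟩ := hA'.exists_cdf_bounds
  have hXL : MemLp X 2 P := by
    rw [← hXμ] at hμ
    exact hμ.comp_of_map hX.aemeasurable
  have hGL : MemLp G 2 P := by
    have h := memLp_id_gaussianReal (μ := 0) (v := 1) 2
    rw [← hGγ] at h
    exact h.comp_of_map hG.aemeasurable
  have hX' := hXL.coeFn_toLp
  have hG' := hGL.coeFn_toLp
  choose T hT hTc hTL hTK hTν hTB using exists_bass_transport (P := P) (X := X) hG hGγ hXG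
    hab hm hM ha hb hlow hup
  choose Y hY using fun Z => exists_L2_comp (P := P) (hTc Z) (hTK Z) hX hG Z
  have hL0 : 0 < 1 / m := by positivity
  have hopt := fun Z => bass_optimal hX' hG' hL0 (hT Z) (hTc Z) (hTL Z) (hTK Z) hG Z (hTν Z)
    (Y Z) (hY Z)
  -- Directions are `𝒢`-measurable, so only the projection of `Y Z - X` onto `L²(𝒢)` matters.
  set D : L2 (sigmaX X) P → L2 (sigmaX X) P := fun Z =>
    condExpL2 ℝ ℝ hX.comap_le ((Y Z : Lp ℝ 2 P) - hXL.toLp X) with hDdef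
  have hD : ∀ Z W : L2 (sigmaX X) P,
      inner ℝ (D Z) W = inner ℝ ((Y Z : Lp ℝ 2 P) - hXL.toLp X) (W : Lp ℝ 2 P) := fun Z W => by
    rw [Submodule.coe_inner]
    exact inner_condExpL2_eq_inner_fun hX.comap_le _ _ (lpMeas.aestronglyMeasurable W)
  have hV := fun Z => (hopt Z).2.1
  have hgap := fun Z Z' => (hopt Z).2.2 (Y Z') (hopt Z').1
  -- Covers `x + s` for `x ∈ [0, 1]` and `|s| ≤ 2R`, the range of `Z₁ - Z₀`.
  set B := 2 * R + 1 with hB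
  set c := gaussianPDFReal 0 1 (B + R) / M with hc
  have hc0 : 0 < c := div_pos (gaussianPDFReal_pos _ _ _ one_ne_zero) hM
  have hq0 : 0 < gaussianPDFReal 0 1 B := gaussianPDFReal_pos _ _ _ one_ne_zero
  set ε := gaussianPDFReal 0 1 B * c ^ 2 / (2 * (1 / m)) with hε
  have hmain : ∀ Z₀ Z₁ : L2 (sigmaX X) P,
      (∀ᵐ ω ∂P, |(Z₀ : Ω → ℝ) ω| ≤ R) → (∀ᵐ ω ∂P, |(Z₁ : Ω → ℝ) ω| ≤ R) →
      ∫ ω, (Z₁ : Ω → ℝ) ω ∂P = ∫ ω, (Z₀ : Ω → ℝ) ω ∂P → ε * ‖Z₁ - Z₀‖ ^ 2 ≤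
        bassV P X G ν Z₁ - bassV P X G ν Z₀ - inner ℝ (D Z₀) (Z₁ - Z₀) :=
    fun Z₀ Z₁ h0 h1 hmean => by
      refine le_trans ?_ (gradient_gap hV hgap hD Z₀ Z₁)
      rw [hε, div_mul_eq_mul_div]
      gcongr
      exact mul_norm_sub_sq_le_of_transport hG hGγ hXG (hTc Z₀) (hTc Z₁) (hTK Z₀) (hTK Z₁) hB.ge
        hc0.le hR.le (hTB Z₁ R B h1) h0 h1 hmean (hY Z₀) (hY Z₁)
  refine ⟨ε, by positivity, fun Z₀ Z₁ h0 h1 hmean => ⟨D Z₀,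
    hasFDerivAt_of_gradient_gap hL0 hV hgap hD Z₀, hmain Z₀ Z₁ h0 h1 hmean⟩, fun c' =>
    strongConvexOn_of_gradient_le (convex_bounded_mean R c') fun Z₀ h0 Z₁ h1 =>
      hmain Z₀ Z₁ h0.1 h1.1 (h1.2.trans h0.2.symm)⟩
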